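/- Let $H$ be a real Hilbert space, $C\subset H$ nonempty, bounded, closed and convex, and $U\subset H$ open and convex with $C\subset U$. Let $j$ be continuously Fréchet differentiable on $U$ with $L$-Lipschitz gradient $\nabla j$ on $U$ for some $L\ge 0$, and let $\eta:H\to\mathbb{R}$ be convex, lower semicontinuous, and locally Lipschitz on $C$. Put $\varphi:=j+\eta$ and, for $u\in C$, $$S(u):=-\nabla j(u)-\partial\eta(u)-N_C(u),$$ where $\partial\eta(u)=\{v\in H:\ \langle y-u,v\rangle+\eta(u)\le\eta(y)\ \ \forall y\in H\}$ and $N_C(u)=\{v\in H:\ \langle v,w-u\rangle\le 0\ \ \forall w\in C\}$. Let $z:[0,\infty)\to C$ be a trajectory of the differential inclusion $\dot z(t)\in S(z(t))$, that is, $z$ is continuous on $[0,\infty)$, absolutely continuous on every compact interval $[a,b]\subset(0,\infty)$, and for almost every $t>0$ it is differentiable at $t$ with $\dot z(t)\in S(z(t))$. Suppose that $0\notin S(z(0))$. Then $t\mapsto\varphi(z(t))$ is nonincreasing on $[0,\infty)$, and there exists $T>0$ such that $$\varphi(z(T))<\sup_{t\in[0,T]}\varphi(z(t))\le\varphi(z(0)),$$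 the supremum being finite. -/

import Mathlib

open Set MeasureTheory
open scoped NNReal Pointwise

namespace DescentInclusion

variable {H : Type*} [NormedAddCommGroup H] [InnerProductSpace ℝ H]

/-- The subdifferential, in the sense of convex analysis, of a finite-valued function. -/
def subdifferential (η : H → ℝ) (u : H) : Set H :=
  {v : H | ∀ y : H, inner ℝ (y - u) v + η u ≤ η y}

/-- The normal cone to `C` at `u`; it is empty when `u ∉ C`. -/
def normalCone (C : Set H) (u : H) : Set H :=
  {v : H | u ∈ C ∧ ∀ w ∈ C, inner ℝ v (w - u) ≤ 0}

/-- `j ∈ C^{1,1}_L(U)`: continuously differentiable on `U` with an `L`-Lipschitz gradient. -/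
def IsC11On [CompleteSpace H] (L : ℝ≥0) (j : H → ℝ) (U : Set H) : Prop :=
  ContDiffOn ℝ 1 j U ∧ LipschitzOnWith L (gradient j) U

/-- The set-valued map `S(u) = -∇j(u) - ∂η(u) - N_C(u)`, a Minkowski difference of sets. -/
def inclusionMap [CompleteSpace H] (j η : H → ℝ) (C : Set H) (u : H) : Set H :=
  ({-gradient j u} : Set H) - subdifferential η u - normalCone C u

/-- `z : [0,∞) → C` is a trajectory (strong solution) of `ż(t) ∈ S(z(t))`: it is continuous on
`[0,∞)`, absolutely continuous on compact subintervals of `(0,∞)`, and the inclusion holds for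
almost every `t`. Only the values of `z` on `[0,∞)` matter. -/
structure IsTrajectory (S : H → Set H) (C : Set H) (z : ℝ → H) : Prop where
  mem : ∀ t : ℝ, 0 ≤ t → z t ∈ C
  continuousOn : ContinuousOn z (Ici 0)
  absolutelyContinuous :
    ∀ a b : ℝ, 0 < a → a ≤ b → AbsolutelyContinuousOnInterval z a b
  inclusion : ∀ᵐ t ∂(volume.restrict (Ioi (0 : ℝ))),
    DifferentiableAt ℝ z t ∧ deriv z t ∈ S (z t)

end DescentInclusion

namespace DescentInclusion

variable {H : Type*} [NormedAddCommGroup H] [InnerProductSpace ℝ H]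

/-! At almost every time the energy `φ ∘ z` has derivative `-‖ż‖²`. Every subgradient gives the same
chain rule, since its affine minorant touches `η` at `z t`; normal vectors drop out, since the curve
stays in `C` on both sides of `t`. Absolute continuity integrates this to monotonicity. If the
energy never drops below its initial value, then `ż = 0` almost everywhere, so `z` is constant and
the inclusion at any good time puts `0` in `S (z 0)`. -/

/-- A locally Lipschitz function of an absolutely continuous curve is absolutely continuous. -/
theorem _root_.LocallyLipschitzOn.comp_absolutelyContinuousOnInterval
    {X Y : Type*} [SeminormedAddCommGroup X] [PseudoMetricSpace Y] {f : X → Y} {s : Set X}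
    {z : ℝ → X} {a b : ℝ} (hf : LocallyLipschitzOn s f)
    (hz : AbsolutelyContinuousOnInterval z a b) (hzs : MapsTo z (uIcc a b) s) :
    AbsolutelyContinuousOnInterval (fun t => f (z t)) a b := by
  have hcompact : IsCompact (z '' uIcc a b) :=
    isCompact_uIcc.image_of_continuousOn hz.continuousOn
  obtain ⟨K, hK⟩ := LocallyLipschitzOn.exists_lipschitzOnWith_of_compact hcompact
    (hf.mono hzs.image_subset)
  rw [absolutelyContinuousOnInterval_iff] at hz ⊢
  intro ε hε
  -- Dividing by `K + 1` also covers `K = 0`.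
  obtain ⟨δ, hδ, h⟩ := hz (ε / (K + 1)) (by positivity)
  refine ⟨δ, hδ, fun E hE hEδ => ?_⟩
  have hpos : (0 : ℝ) < K + 1 := by positivity
  have hsum := h E hE hEδ
  rw [lt_div_iff₀ hpos] at hsum
  refine lt_of_le_of_lt ?_ hsum
  rw [Finset.sum_mul]
  refine Finset.sum_le_sum fun i hi => ?_
  have h1 := hK.dist_le_mul _ (mem_image_of_mem z (hE.1 i hi).1) _
    (mem_image_of_mem z (hE.1 i hi).2)
  nlinarith [dist_nonneg (x := z (E.2 i).1) (y := z (E.2 i).2)]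

/-- A `C¹` function on an open set is locally Lipschitz there. -/
theorem _root_.ContDiffOn.locallyLipschitzOn_of_isOpen
    {E F : Type*} [NormedAddCommGroup E] [NormedSpace ℝ E] [NormedAddCommGroup F]
    [NormedSpace ℝ F] {f : E → F} {U : Set E} (hf : ContDiffOn ℝ 1 f U) (hU : IsOpen U) :
    LocallyLipschitzOn U f := by
  intro x hx
  obtain ⟨K, t, ht, hK⟩ := (hf.contDiffAt (hU.mem_nhds hx)).exists_lipschitzOnWith
  exact ⟨K, t, mem_nhdsWithin_of_mem_nhds ht, hK⟩

/-- Chain rule along a curve for a convex function, with any choice of subgradient. -/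
theorem hasDerivAt_comp_of_mem_subdifferential {η : H → ℝ} {z : ℝ → H} {z' v : H} {t : ℝ}
    (hv : v ∈ subdifferential η (z t)) (hz : HasDerivAt z z' t)
    (hη : DifferentiableAt ℝ (fun s => η (z s)) t) :
    HasDerivAt (fun s => η (z s)) (inner ℝ z' v) t := by
  have hlin : HasDerivAt (fun s => inner ℝ (z s - z t) v) (inner ℝ z' v) t := by
    simpa using (hz.sub_const (z t)).inner ℝ (hasDerivAt_const t v)
  have hmin : IsLocalMin (fun s => η (z s) - inner ℝ (z s - z t) v) t := by
    refine Filter.Eventually.of_forall fun s => ?_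
    have := hv (z s)
    simp only [sub_self, inner_zero_left]
    linarith
  have h0 := hmin.hasDerivAt_eq_zero (hη.hasDerivAt.sub hlin)
  rw [← sub_eq_zero.1 h0]
  exact hη.hasDerivAt

/-- Normal vectors are orthogonal to the velocity of a curve that stays in the set. -/
theorem inner_eq_zero_of_mem_normalCone {C : Set H} {z : ℝ → H} {z' n : H} {t : ℝ}
    (hn : n ∈ normalCone C (z t)) (hz : HasDerivAt z z' t)
    (hC : ∀ᶠ s in nhds t, z s ∈ C) : inner ℝ n z' = 0 := by
  have hlin : HasDerivAt (fun s => inner ℝ n (z s - z t)) (inner ℝ n z') t := by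
    simpa using (hasDerivAt_const t n).inner ℝ (hz.sub_const (z t))
  refine IsLocalMax.hasDerivAt_eq_zero ?_ hlin
  filter_upwards [hC] with s hs
  simpa using hn.2 _ hs

/-- The energy identity `(φ ∘ z)' = -‖z'‖²` at a point where the inclusion holds. -/
theorem hasDerivAt_energy [CompleteSpace H] {j η : H → ℝ} {C : Set H} {z : ℝ → H} {z' : H}
    {t : ℝ} (hj : DifferentiableAt ℝ j (z t)) (hz : HasDerivAt z z' t)
    (hη : DifferentiableAt ℝ (fun s => η (z s)) t) (hC : ∀ᶠ s in nhds t, z s ∈ C)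
    (hS : z' ∈ inclusionMap j η C (z t)) :
    HasDerivAt (fun s => j (z s) + η (z s)) (-‖z'‖ ^ 2) t := by
  obtain ⟨_, ⟨g, hg, v, hv, rfl⟩, n, hn, hsum⟩ := hS
  rw [mem_singleton_iff] at hg
  subst hg
  have hjz : HasDerivAt (fun s => j (z s)) (inner ℝ (gradient j (z t)) z') t := by
    have h := hj.hasGradientAt.hasFDerivAt.comp_hasDerivAt t hz
    rwa [InnerProductSpace.toDual_apply_apply] at h
  refine (hjz.add (hasDerivAt_comp_of_mem_subdifferential hv hz hη)).congr_deriv ?_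
  have hn0 := inner_eq_zero_of_mem_normalCone hn hz hC
  have hz' : gradient j (z t) = -z' - v - n := by
    rw [← hsum]
    simp only
    abel
  rw [hz', inner_sub_left, inner_sub_left, inner_neg_left, hn0, real_inner_self_eq_norm_sq,
    real_inner_comm v z']
  ring

namespace IsTrajectory

variable {C U : Set H} {j η : H → ℝ} {z : ℝ → H}

theorem absolutelyContinuousOnInterval_comp {S : H → Set H} (hz : IsTrajectory S C z)
    {f : H → ℝ} (hf : LocallyLipschitzOn C f) {a b : ℝ} (ha : 0 < a) (hab : a ≤ b) :
    AbsolutelyContinuousOnInterval (fun t => f (z t)) a b := by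
  refine hf.comp_absolutelyContinuousOnInterval (hz.absolutelyContinuous a b ha hab) fun t ht => ?_
  rw [uIcc_of_le hab] at ht
  exact hz.mem t (ha.le.trans ht.1)

variable [CompleteSpace H]

/-- Differentiability of `η ∘ z` almost everywhere comes from its absolute continuity, as `η` itself
need not be differentiable. -/
theorem ae_hasDerivAt_energy (hz : IsTrajectory (inclusionMap j η C) C z)
    (hU : IsOpen U) (hCU : C ⊆ U) (hj : ContDiffOn ℝ 1 j U) (hη : LocallyLipschitzOn C η)
    {a b : ℝ} (ha : 0 < a) (hab : a ≤ b) :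
    ∀ᵐ t, t ∈ uIcc a b → HasDerivAt z (deriv z t) t ∧ deriv z t ∈ inclusionMap j η C (z t) ∧
      HasDerivAt (fun s => j (z s) + η (z s)) (-‖deriv z t‖ ^ 2) t := by
  filter_upwards [(ae_restrict_iff' measurableSet_Ioi).1 hz.inclusion,
    (hz.absolutelyContinuousOnInterval_comp hη ha hab).ae_differentiableAt] with t hS hdiff ht
  have ht0 : 0 < t := ha.trans_le (uIcc_of_le hab ▸ ht).1
  obtain ⟨hzd, hzS⟩ := hS ht0
  refine ⟨hzd.hasDerivAt, hzS, hasDerivAt_energy ?_ hzd.hasDerivAt (hdiff ht) ?_ hzS⟩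
  · exact (hj.contDiffAt (hU.mem_nhds (hCU (hz.mem t ht0.le)))).differentiableAt one_ne_zero
  · filter_upwards [lt_mem_nhds ht0] with s hs using hz.mem s hs.le

theorem antitoneOn_energy (hz : IsTrajectory (inclusionMap j η C) C z)
    (hU : IsOpen U) (hCU : C ⊆ U) (hj : ContDiffOn ℝ 1 j U) (hη : LocallyLipschitzOn C η) :
    AntitoneOn (fun t => j (z t) + η (z t)) (Ici 0) := by
  have hφ : LocallyLipschitzOn C (fun x => j x + η x) :=
    ((hj.locallyLipschitzOn_of_isOpen hU).mono hCU).add hη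
  have hpos : ∀ a b : ℝ, 0 < a → a ≤ b → j (z b) + η (z b) ≤ j (z a) + η (z a) := by
    intro a b ha hab
    have hint := (hz.absolutelyContinuousOnInterval_comp hφ ha hab).integral_deriv_eq_sub
    have hle : ∫ t in a..b, deriv (fun s => j (z s) + η (z s)) t ≤ 0 := by
      rw [intervalIntegral.integral_of_le hab]
      refine setIntegral_nonpos_of_ae_restrict
        ((ae_restrict_iff' measurableSet_Ioc).2 ?_)
      filter_upwards [hz.ae_hasDerivAt_energy hU hCU hj hη ha hab] with t h ht
      rw [(h (uIcc_of_le hab ▸ Ioc_subset_Icc_self ht)).2.2.deriv]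
      simp
    linarith
  intro a ha b hb hab
  -- Absolute continuity is only available away from `0`, so the endpoint is reached by continuity,
  -- letting `s → 0⁺`.
  rcases (mem_Ici.1 ha).eq_or_lt with rfl | ha
  · rcases hab.eq_or_lt with rfl | hb
    · exact le_rfl
    have hcont : ContinuousOn (fun t => j (z t) + η (z t)) (Ici 0) :=
      hφ.continuousOn.comp hz.continuousOn fun t ht => hz.mem t ht
    refine ge_of_tendsto ((hcont 0 self_mem_Ici).mono_left
      (nhdsWithin_mono 0 Ioi_subset_Ici_self)) ?_
    filter_upwards [Ioo_mem_nhdsGT hb] with s hs using hpos s b hs.1 hs.2.le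
  · exact hpos a b ha hab

/-- A trajectory along which the energy is constant rests at an equilibrium. -/
theorem zero_mem_of_energy_eq (hz : IsTrajectory (inclusionMap j η C) C z)
    (hU : IsOpen U) (hCU : C ⊆ U) (hj : ContDiffOn ℝ 1 j U) (hη : LocallyLipschitzOn C η)
    (hconst : ∀ t, 0 < t → j (z t) + η (z t) = j (z 0) + η (z 0)) :
    (0 : H) ∈ inclusionMap j η C (z 0) := by
  have hae : ∀ a b : ℝ, 0 < a → a ≤ b →
      ∀ᵐ t, t ∈ uIcc a b → HasDerivAt z 0 t ∧ (0 : H) ∈ inclusionMap j η C (z t) := by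
    intro a b ha hab
    filter_upwards [hz.ae_hasDerivAt_energy hU hCU hj hη ha hab] with t h ht
    obtain ⟨hzd, hS, hφ⟩ := h ht
    have ht0 : 0 < t := ha.trans_le (uIcc_of_le hab ▸ ht).1
    have hloc : (fun s => j (z s) + η (z s)) =ᶠ[nhds t] fun _ => j (z 0) + η (z 0) := by
      filter_upwards [lt_mem_nhds ht0] with s hs using hconst s hs
    have h0 := hφ.unique ((hasDerivAt_const t _).congr_of_eventuallyEq hloc)
    have hz' : deriv z t = 0 := by simpa using h0
    rw [hz'] at hzd hS
    exact ⟨hzd, hS⟩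
  have hle : ∀ a b : ℝ, 0 < a → a ≤ b → z a = z b := by
    intro a b ha hab
    obtain ⟨c, hc⟩ :=
      (hz.absolutelyContinuous a b ha hab).const_of_ae_hasDerivAt_zero
        ((hae a b ha hab).mono fun t h ht => (h ht).1)
    rw [hc a left_mem_uIcc, hc b right_mem_uIcc]
  have hz1 : ∀ t, 0 < t → z t = z 1 := fun t ht =>
    (le_total t 1).elim (hle t 1 ht) fun h => (hle 1 t one_pos h).symm
  have hz0 : z 0 = z 1 := by
    refine tendsto_nhds_unique ((hz.continuousOn 0 self_mem_Ici).mono_left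
      (nhdsWithin_mono 0 Ioi_subset_Ici_self)) (tendsto_const_nhds.congr' ?_)
    filter_upwards [self_mem_nhdsWithin] with t ht using (hz1 t ht).symm
  -- The inclusion may fail at time `0` itself; an interval of positive measure contains a time
  -- where it holds.
  have hne : (ae (volume.restrict (Icc (1 : ℝ) 2))).NeBot := by
    rw [ae_neBot, Ne, Measure.restrict_eq_zero]
    simp
  have h12 := hae 1 2 one_pos one_le_two
  rw [uIcc_of_le one_le_two, ← ae_restrict_iff' measurableSet_Icc] at h12
  obtain ⟨t, ⟨-, ht⟩, ht12⟩ := (h12.and (ae_restrict_mem measurableSet_Icc)).exists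
  rwa [hz0, ← hz1 t (one_pos.trans_le ht12.1)]

end IsTrajectory

end DescentInclusion

theorem mainTheorem7 {H : Type*} [NormedAddCommGroup H] [InnerProductSpace ℝ H] [CompleteSpace H]
    (C U : Set H) (L : ℝ≥0) (j η : H → ℝ) (z : ℝ → H)
    (hC_nonempty : C.Nonempty) (hC_bounded : Bornology.IsBounded C)
    (hC_convex : Convex ℝ C) (hC_closed : IsClosed C)
    (hU_open : IsOpen U) (hU_convex : Convex ℝ U) (hCU : C ⊆ U)
    (hj : DescentInclusion.IsC11On L j U)
    (hη_convex : ConvexOn ℝ univ η) (hη_lsc : LowerSemicontinuous η)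
    (hη_lip : LocallyLipschitzOn C η)
    (hz : DescentInclusion.IsTrajectory (DescentInclusion.inclusionMap j η C) C z)
    (hz0 : (0 : H) ∉ DescentInclusion.inclusionMap j η C (z 0)) :
    AntitoneOn (fun t : ℝ => j (z t) + η (z t)) (Ici 0) ∧
    ∃ T : ℝ, 0 < T ∧
      BddAbove ((fun t : ℝ => j (z t) + η (z t)) '' Icc 0 T) ∧
      j (z T) + η (z T) < sSup ((fun t : ℝ => j (z t) + η (z t)) '' Icc 0 T) ∧
      sSup ((fun t : ℝ => j (z t) + η (z t)) '' Icc 0 T) ≤ j (z 0) + η (z 0) := by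
  have hanti := hz.antitoneOn_energy hU_open hCU hj.1 hη_lip
  obtain ⟨T, hT, hlt⟩ : ∃ T : ℝ, 0 < T ∧ j (z T) + η (z T) < j (z 0) + η (z 0) := by
    by_contra! h
    exact hz0 (hz.zero_mem_of_energy_eq hU_open hCU hj.1 hη_lip fun t ht =>
      (hanti self_mem_Ici ht.le ht.le).antisymm (h t ht))
  have hgreatest : IsGreatest ((fun t : ℝ => j (z t) + η (z t)) '' Icc 0 T)
      (j (z 0) + η (z 0)) := by
    refine ⟨⟨0, left_mem_Icc.2 hT.le, rfl⟩, ?_⟩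
    rintro _ ⟨t, ht, rfl⟩
    exact hanti self_mem_Ici ht.1 ht.1
  exact ⟨hanti, T, hT, hgreatest.bddAbove, hgreatest.csSup_eq.symm ▸ hlt,
    hgreatest.csSup_eq.le⟩
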